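/- **Theorem.** Let $(F,d)$ be a non-empty totally bounded metric space. For each integer $q\ge 1$ let $P(q)\subseteq F$ be a $(1/q)$-separated set (that is, $d(p_1,p_2)\ge 1/q$ for all distinct $p_1,p_2\in P(q)$) which is maximal with this property with respect to inclusion. For $t\ge 1$ let $$F_t=\bigcap_{N\in\mathbb N}\ \bigcup_{q>N}\ \bigcup_{p\in P(q)}\{x\in F: d(p,x)\le q^{-t}\}.$$ Then for all $t\ge 1$ $$\dim_{\mathrm H}F_t\le\frac{\dim_{\mathrm P}F+1}{t},$$ and, if $F$ is compact, then also $$\dim_{\mathrm P}F_t\ge\frac{\dim_{\mathrm L}F}{t}.$$ Here all dimensions take values in $[0,\infty]$, and $\dim_{\mathrm H}$ is the Hausdorff dimension. For $X\subseteq F$ and $r>0$ let $N_r(X)\in\{0,1,2,\dots,\infty\}$ be the supremum of the cardinalities of the $r$-separated subsets of $X$. The upper box dimension of a non-empty set $X$ is $\overline{\dim}_{\mathrm B}X=\limsup_{r\to0^+}\frac{\log N_r(X)}{-\log r}$ (and $\overline{\dim}_{\mathrm B}\emptyset=0$), and the packing dimension is $$\dim_{\mathrm P}X=\inf\Big\{\sup_{i\in\mathbb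 N}\overline{\dim}_{\mathrm B}X_i\ :\ X=\bigcup_{i\in\mathbb N}X_i\Big\}.$$ The lower dimension $\dim_{\mathrm L}X$ of a set $X$ with at least two points is the supremum of all real $s\ge0$ for which there is a constant $C>0$ such that $N_r(B(x,R)\cap X)\ge C(R/r)^s$ for all $x\in X$ and all $0<r<R\le|X|$, where $B(x,R)$ is the closed ball and $|X|$ the diameter of $X$; for a set with at most one point, $\dim_{\mathrm L}X=0$. -/

import Mathlib

open Set Filter Topology
open scoped NNReal ENNReal

noncomputable section

namespace AbstractRationals

variable {F : Type*} [MetricSpace F]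

/-- `S` is `r`-separated: distinct points of `S` are at distance at least `r`
(non-strict inequality). -/
def IsSep (r : ℝ) (S : Set F) : Prop :=
  ∀ p₁ ∈ S, ∀ p₂ ∈ S, p₁ ≠ p₂ → r ≤ dist p₁ p₂

/-- `P q` is a choice of abstract rationals of level `q`, for every positive integer `q`:
a subset of the space that is maximal (for inclusion) among the `(1/q)`-separated sets.
The value `P 0` plays no role. -/
def IsChoice (P : ℕ → Set F) : Prop :=
  ∀ q : ℕ, 1 ≤ q → Maximal (fun S : Set F => IsSep (1 / (q : ℝ)) S) (P q)

/-- The set `F_t` of the points `x` such that, for infinitely many `q`, there is a `p ∈ P q`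
with `d(p, x) ≤ 1 / q ^ t`. -/
def approxSet (P : ℕ → Set F) (t : ℝ) : Set F :=
  {x | ∀ N : ℕ, ∃ q : ℕ, N < q ∧ ∃ p ∈ P q, dist p x ≤ 1 / (q : ℝ) ^ t}

/-- `N_r(X)`: the largest cardinality of an `r`-separated subset of `X`
(`⊤` if these cardinalities are unbounded). -/
def sepNum (r : ℝ) (X : Set F) : ℕ∞ :=
  ⨆ (S : Set F) (_ : S ⊆ X) (_ : IsSep r S), S.encard

/-- Upper box dimension, `limsup_{r → 0+} log N_r(X) / (- log r)`, with values in `[0, ∞]`.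
For nonempty `X` one has `log N_r(X) ≥ 0`, so `toENNReal` changes nothing there;
the empty set gets dimension `0`. -/
def upperBoxDim (X : Set F) : ℝ≥0∞ :=
  limsup (fun r : ℝ =>
    (ENNReal.log (sepNum r X : ℝ≥0∞)).toENNReal / ENNReal.ofReal (-Real.log r)) (𝓝[>] 0)

/-- Packing dimension: the infimum, over the countable decompositions `X = ⋃ i, A i`, of
`sup_i` of the upper box dimensions of the pieces. -/
def packingDim (X : Set F) : ℝ≥0∞ :=
  ⨅ (A : ℕ → Set F) (_ : X = ⋃ i, A i), ⨆ i, upperBoxDim (A i)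

/-- The scaling condition in the definition of the lower dimension: there is `C > 0` with
`N_r(B(x,R) ∩ X) ≥ C (R/r)^s` for all `0 < r < R ≤ diam X` and all `x ∈ X`
(`B` is the closed ball). -/
def LowerScaling (X : Set F) (s : ℝ≥0) : Prop :=
  ∃ C : ℝ, 0 < C ∧ ∀ r R : ℝ, 0 < r → r < R → ENNReal.ofReal R ≤ Metric.ediam X →
    ∀ x ∈ X, ENNReal.ofReal (C * (R / r) ^ (s : ℝ)) ≤
      (sepNum r (Metric.closedBall x R ∩ X) : ℝ≥0∞)

open Classical in
/-- Lower dimension, with values in `[0, ∞]`. A set with at most one point has no scales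
`0 < r < R ≤ diam X`, so that the scaling condition is void for it; its lower dimension
is `0` by convention. -/
def lowerDim (X : Set F) : ℝ≥0∞ :=
  if X.Subsingleton then 0 else ⨆ (s : ℝ≥0) (_ : LowerScaling X s), (s : ℝ≥0∞)

end AbstractRationals

end

/-! Upper bound: dimH is countably stable, so it suffices to treat `approxSet P t ∩ X` with
`upperBoxDim X < s`. For t > 1 the points of `P q` within q^(-t) of X can be moved into X and stay
1/(2q)-separated, so there are O(q^s) of them; covering by their balls costs ∑ q^s q^(-td), finite
for d > (s+1)/t (`dimH_le_of_limsup_cover`). Lower bound: by Baire's theorem some piece of any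
countable decomposition of `approxSet P t` is dense in a ball. Box dimension does not distinguish a
set from its closure, and balls have upper box dimension at least `lowerDim`. This gives the bound
even without the factor 1/t. -/

open MeasureTheory Measure in
theorem dimH_le_of_limsup_cover {X : Type*} [MetricSpace X] {E : Set X} {C : ℕ → Set X}
    {s t : ℝ} (K : ℝ) (hs : 0 ≤ s) (ht : 0 < t)
    (hC : ∀ᶠ q in atTop, ((C q).encard : ℝ≥0∞) ≤ ENNReal.ofReal (K * (q : ℝ) ^ s))
    (hE : ∀ x ∈ E, ∀ N : ℕ, ∃ q, N < q ∧ ∃ p ∈ C q, dist p x ≤ 1 / (q : ℝ) ^ t) :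
    dimH E ≤ ENNReal.ofReal ((s + 1) / t) := by
  borelize X
  refine le_of_forall_gt_imp_ge_of_dense fun d' hd' => ?_
  rcases eq_or_ne d' ∞ with rfl | htop
  · exact le_top
  lift d' to ℝ≥0 using htop
  obtain ⟨N₀, hN₀⟩ := eventually_atTop.1 hC
  have hd : s - t * d' < -1 := by
    have h : (s + 1) / t < d' := by
      have := ENNReal.ofReal_lt_iff_lt_toReal (by positivity) ENNReal.coe_ne_top |>.1 hd'
      simpa using this
    rw [div_lt_iff₀ ht] at h
    linarith
  have hdnn : (0 : ℝ) ≤ d' := d'.2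
  -- Enumerates a tail of levels q beyond N₀, where the cardinality bound holds and q ≥ 1.
  let e : ℕ → ℕ → ℕ := fun n k => k + (n + N₀ + 1)
  have hfin : ∀ n k, (C (e n k)).Finite := fun n k => by
    have h := hN₀ (e n k) (by simp only [e]; omega)
    rw [← Set.encard_lt_top_iff]
    by_contra h'
    rw [not_lt, top_le_iff] at h'
    simp [h'] at h
  have : ∀ n, Countable (Σ k, C (e n k)) := fun n => by
    have : ∀ k, Countable (C (e n k)) := fun k => (hfin n k).countable.to_subtype
    infer_instance
  let D : ℕ → ℝ≥0∞ := fun q => ENNReal.ofReal (2 * (q : ℝ) ^ (-t))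
  let a : ℕ → ℝ≥0∞ := fun q => ENNReal.ofReal (K * 2 ^ (d' : ℝ) * (q : ℝ) ^ (s - t * d'))
  have hDmono : ∀ n k, D (e n k) ≤ D (n + 1) := fun n k => by
    refine ENNReal.ofReal_le_ofReal (mul_le_mul_of_nonneg_left ?_ two_pos.le)
    refine Real.rpow_le_rpow_of_nonpos (by positivity) ?_ (by linarith)
    exact_mod_cast (by simp only [e]; omega)
  have hdiam : ∀ (q : ℕ) (p : X), Metric.ediam (Metric.closedBall p (1 / (q : ℝ) ^ t)) ≤ D q := by
    intro q p
    refine Metric.ediam_le_of_forall_dist_le fun x hx y hy => ?_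
    rw [Metric.mem_closedBall] at hx hy
    rw [Real.rpow_neg (by positivity), ← one_div]
    linarith [dist_triangle_right x y p]
  have hD0 : Tendsto (fun n : ℕ => D (n + 1)) atTop (𝓝 0) := by
    have h1 := (tendsto_rpow_neg_atTop ht).comp tendsto_natCast_atTop_atTop
    have h2 := ENNReal.tendsto_ofReal ((h1.comp (tendsto_add_atTop_nat 1)).const_mul 2)
    simpa [D, Function.comp_def] using h2
  have ha : ∑' q, a q ≠ ∞ :=
    ((Real.summable_nat_rpow.2 hd).mul_left _).tsum_ofReal_ne_top
  have hsum : ∀ n, ∑' i : Σ k, C (e n k),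
      Metric.ediam (Metric.closedBall (i.2 : X) (1 / ((e n i.1 : ℕ) : ℝ) ^ t)) ^ (d' : ℝ) ≤
        ∑' k, a (k + (n + N₀ + 1)) := by
    intro n
    rw [ENNReal.tsum_sigma']
    refine ENNReal.tsum_le_tsum fun k => ?_
    refine (ENNReal.tsum_le_tsum fun p : C (e n k) =>
      ENNReal.rpow_le_rpow (hdiam (e n k) (p : X)) hdnn).trans ?_
    rw [ENNReal.tsum_const]
    have hq : (0 : ℝ) < e n k := by simp only [e]; positivity
    calc (ENat.card (C (e n k)) : ℝ≥0∞) * D (e n k) ^ (d' : ℝ)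
        ≤ ENNReal.ofReal (K * (e n k : ℝ) ^ s) * D (e n k) ^ (d' : ℝ) :=
          mul_le_mul_left (hN₀ (e n k) (by simp only [e]; omega)) _
      _ = a (e n k) := by
          simp only [D, a]
          rw [ENNReal.ofReal_rpow_of_nonneg (by positivity) hdnn,
            ← ENNReal.ofReal_mul' (by positivity), Real.mul_rpow (by positivity) (by positivity),
            ← Real.rpow_mul hq.le, sub_eq_add_neg, Real.rpow_add hq, neg_mul]
          ring_nf
  refine dimH_le_of_hausdorffMeasure_ne_top (ne_of_lt (lt_of_le_of_lt
    (hausdorffMeasure_le_liminf_tsum (d' : ℝ) E (l := atTop) (fun n : ℕ => D (n + 1)) hD0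
      (fun n (i : Σ k, C (e n k)) => Metric.closedBall (i.2 : X) (1 / ((e n i.1 : ℕ) : ℝ) ^ t))
      (Eventually.of_forall fun n i => (hdiam _ _).trans (hDmono n i.1))
      (Eventually.of_forall fun n x hx => ?_)) (lt_of_le_of_lt (b := 0) ?_ ENNReal.zero_lt_top)))
  · obtain ⟨q, hq, p, hp, hpx⟩ := hE x hx (n + N₀ + 1)
    obtain ⟨k, rfl⟩ : ∃ k, q = e n k := ⟨q - (n + N₀ + 1), by simp only [e]; omega⟩
    exact mem_iUnion.2 ⟨⟨k, p, hp⟩, by rw [Metric.mem_closedBall, dist_comm]; exact hpx⟩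
  · have h0 : Tendsto (fun n => ∑' k, a (k + (n + N₀ + 1))) atTop (𝓝 0) :=
      (ENNReal.tendsto_sum_nat_add a ha).comp (tendsto_add_atTop_nat (N₀ + 1))
    rw [← h0.liminf_eq]
    exact liminf_le_liminf (Eventually.of_forall hsum)

/-! ### Separated sets and upper box dimension. -/

namespace AbstractRationals

/-- Truncating the logarithm at 0 is harmless because s · (-log r) ≥ 0. -/
theorem log_ratio_le_iff {N : ℝ≥0∞} {r : ℝ} (hr : 0 < r) (hr1 : r < 1) (s : ℝ≥0) :
    (ENNReal.log N).toENNReal / ENNReal.ofReal (-Real.log r) ≤ s ↔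
      N ≤ ENNReal.ofReal (r ^ (-(s : ℝ))) := by
  have hlog : 0 < -Real.log r := by linarith [Real.log_neg hr hr1]
  have h0 : 0 ≤ (s : ℝ) * -Real.log r := by positivity
  have h : ENNReal.log (ENNReal.ofReal (r ^ (-(s : ℝ)))) = ((s * -Real.log r : ℝ) : EReal) := by
    rw [ENNReal.log_ofReal_of_pos (by positivity), Real.log_rpow hr]
    ring_nf
  rw [ENNReal.div_le_iff (by simpa using hlog) ENNReal.ofReal_ne_top, ← ENNReal.log_le_log_iff (y := ENNReal.ofReal _), h,
    ← ENNReal.ofReal_coe_nnreal, ← ENNReal.ofReal_mul (NNReal.coe_nonneg s), ← EReal.real_coe_toENNReal]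
  refine ⟨fun h' => ?_, EReal.toENNReal_le_toENNReal⟩
  by_contra! hlt
  exact absurd h' (not_le.2 (EReal.toENNReal_lt_toENNReal (mod_cast h0) hlt))

variable {F : Type*} [MetricSpace F]

theorem IsSep.subset {r : ℝ} {S T : Set F} (h : IsSep r S) (hT : T ⊆ S) : IsSep r T :=
  fun p hp p' hp' hne => h p (hT hp) p' (hT hp') hne

theorem IsSep.encard_le {r : ℝ} {S X : Set F} (h : IsSep r S) (hS : S ⊆ X) :
    S.encard ≤ sepNum r X :=
  le_iSup_of_le S (le_iSup_of_le hS (le_iSup_of_le h le_rfl))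

/-- A separated set whose points are close to `X` injects into a separated subset of `X`. -/
theorem IsSep.encard_le_of_near {r δ r' : ℝ} {S X : Set F} (h : IsSep r S) (hr' : 0 < r')
    (hδ : r' + 2 * δ ≤ r) (hX : ∀ p ∈ S, ∃ x ∈ X, dist p x ≤ δ) : S.encard ≤ sepNum r' X := by
  choose! f hfX hf using hX
  have hsep : ∀ p ∈ S, ∀ p' ∈ S, p ≠ p' → r' ≤ dist (f p) (f p') := fun p hp p' hp' hne => by
    linarith [h p hp p' hp' hne, hf p hp, hf p' hp', dist_triangle4 p (f p) (f p') p',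
      dist_comm (f p') p']
  have hinj : InjOn f S := fun p hp p' hp' heq => by
    by_contra hne
    have := hsep p hp p' hp' hne
    rw [heq, dist_self] at this
    linarith
  rw [← hinj.encard_image]
  refine IsSep.encard_le ?_ (image_subset_iff.2 hfX)
  rintro _ ⟨p, hp, rfl⟩ _ ⟨p', hp', rfl⟩ hne
  exact hsep p hp p' hp' fun h => hne (h ▸ rfl)

theorem sepNum_le_of_near {r δ r' : ℝ} {X Y : Set F} (hr' : 0 < r')
    (hδ : r' + 2 * δ ≤ r) (hX : ∀ p ∈ Y, ∃ x ∈ X, dist p x ≤ δ) : sepNum r Y ≤ sepNum r' X :=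
  iSup_le fun _ => iSup_le fun hS => iSup_le fun h =>
    h.encard_le_of_near hr' hδ fun p hp => hX p (hS hp)

theorem exists_isSep_covering {r : ℝ} (hr : 0 ≤ r) (X : Set F) :
    ∃ S ⊆ X, IsSep r S ∧ ∀ x ∈ X, ∃ p ∈ S, dist p x ≤ r := by
  obtain ⟨S, hS⟩ := zorn_subset {S : Set F | S ⊆ X ∧ IsSep r S} (fun c hc hchain =>
    ⟨⋃₀ c, ⟨sUnion_subset fun S hS => (hc hS).1, fun p hp p' hp' hne => by
      obtain ⟨A, hA, hpA⟩ := hp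
      obtain ⟨B, hB, hpB⟩ := hp'
      rcases hchain.total hA hB with h | h
      · exact (hc hB).2 p (h hpA) p' hpB hne
      · exact (hc hA).2 p hpA p' (h hpB) hne⟩, fun S hS => subset_sUnion_of_mem hS⟩)
  refine ⟨S, hS.prop.1, hS.prop.2, fun x hx => ?_⟩
  by_contra! hfar
  have hmem : insert x S ⊆ S := hS.le_of_ge (y := insert x S)
    ⟨insert_subset hx hS.prop.1, ?_⟩ (subset_insert x S)
  · have hxS := hmem (mem_insert x S)
    have h1 := hfar x hxS
    rw [dist_self] at h1
    linarith
  · rintro p (rfl | hp) p' (rfl | hp') hne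
    · exact absurd rfl hne
    · rw [dist_comm]; exact (hfar p' hp').le
    · exact (hfar p hp).le
    · exact hS.prop.2 p hp p' hp' hne

theorem eventually_sepNum_le {X : Set F} {s : ℝ≥0} (h : upperBoxDim X < s) :
    ∀ᶠ r : ℝ in 𝓝[>] 0, (sepNum r X : ℝ≥0∞) ≤ ENNReal.ofReal (r ^ (-(s : ℝ))) := by
  filter_upwards [eventually_lt_of_limsup_lt h, Ioo_mem_nhdsGT (zero_lt_one' ℝ)] with r hr hr1
  exact (log_ratio_le_iff hr1.1 hr1.2 s).1 hr.le

theorem le_upperBoxDim {X : Set F} {s : ℝ≥0}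
    (h : ∃ᶠ r : ℝ in 𝓝[>] 0, ENNReal.ofReal (r ^ (-(s : ℝ))) < (sepNum r X : ℝ≥0∞)) :
    (s : ℝ≥0∞) ≤ upperBoxDim X := by
  refine le_limsup_of_frequently_le ?_
  refine (h.and_eventually (Ioo_mem_nhdsGT (zero_lt_one' ℝ))).mono fun r hr => ?_
  exact (not_le.1 fun h' => not_lt.2 ((log_ratio_le_iff hr.2.1 hr.2.2 s).1 h') hr.1).le

theorem tendsto_const_div_natCast_nhdsGT {c : ℝ} (hc : 0 < c) :
    Tendsto (fun q : ℕ => c / (q : ℝ)) atTop (𝓝[>] 0) :=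
  tendsto_nhdsWithin_iff.2 ⟨tendsto_const_div_atTop_nhds_zero_nat c,
    (eventually_gt_atTop 0).mono fun q hq => by
      have : (0 : ℝ) < q := by exact_mod_cast hq
      exact div_pos hc this⟩

theorem eventually_sepNum_div_natCast_le {X : Set F} {s : ℝ≥0} (h : upperBoxDim X < s) {c : ℝ}
    (hc : 0 < c) : ∀ᶠ q : ℕ in atTop,
      (sepNum (c / q) X : ℝ≥0∞) ≤ ENNReal.ofReal (c ^ (-(s : ℝ)) * (q : ℝ) ^ (s : ℝ)) := by
  filter_upwards [(tendsto_const_div_natCast_nhdsGT hc).eventually (eventually_sepNum_le h)]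
    with q hq
  rwa [Real.div_rpow hc.le (by positivity), Real.rpow_neg (Nat.cast_nonneg q), div_inv_eq_mul]
    at hq

/-! ### Upper bound for the Hausdorff dimension. -/

theorem dimH_approxSet_inter_le {P : ℕ → Set F} (hP : IsChoice P) {t : ℝ} (ht : 1 ≤ t)
    {X : Set F} {s : ℝ≥0} (h : upperBoxDim X < s) :
    dimH (approxSet P t ∩ X) ≤ ENNReal.ofReal ((s + 1) / t) := by
  rcases ht.eq_or_lt with rfl | ht
  -- At t = 1 the radius equals the separation, so moving centres into X may merge them. Maximal
  -- separated subsets of X replace `P q`: their 1/q-balls cover X at every level.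
  · choose C hCX hC hcov using fun q : ℕ =>
      exists_isSep_covering (r := 1 / (q : ℝ)) (by positivity) X
    refine dimH_le_of_limsup_cover (C := C) (1 ^ (-(s : ℝ))) s.2 one_pos ?_ fun x hx N =>
      ⟨N + 1, N.lt_succ_self, by simpa using hcov (N + 1) x hx.2⟩
    filter_upwards [eventually_sepNum_div_natCast_le h one_pos] with q hq
    exact le_trans (by exact_mod_cast (hC q).encard_le (hCX q)) hq
  · refine dimH_le_of_limsup_cover (C := fun q => {p ∈ P q | ∃ x ∈ X, dist p x ≤ 1 / (q : ℝ) ^ t})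
      ((1 / 2) ^ (-(s : ℝ))) s.2 (by linarith) ?_ fun x hx N => ?_
    -- The 4 makes 2 q^(-t) ≤ 1/(2q), so half of the separation 1/q survives.
    · have hlarge : ∀ᶠ q : ℕ in atTop, 4 ≤ (q : ℝ) ^ (t - 1) :=
        ((tendsto_rpow_atTop (sub_pos.2 ht)).comp tendsto_natCast_atTop_atTop).eventually_ge_atTop 4
      filter_upwards [eventually_sepNum_div_natCast_le h (c := 1 / 2) (by norm_num), hlarge,
        eventually_ge_atTop 1] with q hq hq4 hq1
      refine le_trans ?_ hq
      have hq0 : (0 : ℝ) < q := by exact_mod_cast hq1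
      have hsep : IsSep (1 / (q : ℝ)) {p ∈ P q | ∃ x ∈ X, dist p x ≤ 1 / (q : ℝ) ^ t} :=
        (hP q hq1).prop.subset (sep_subset _ _)
      have hle : 1 / (q : ℝ) ^ t ≤ 1 / (4 * q) := by
        refine one_div_le_one_div_of_le (by positivity) ?_
        calc 4 * (q : ℝ) ≤ (q : ℝ) ^ (t - 1) * q := by gcongr
          _ = (q : ℝ) ^ t := by rw [← Real.rpow_add_one hq0.ne', sub_add_cancel]
      have hδ : 1 / 2 / (q : ℝ) + 2 * (1 / (q : ℝ) ^ t) ≤ 1 / q := by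
        have : 1 / (q : ℝ) = 1 / 2 / (q : ℝ) + 2 * (1 / (4 * q)) := by field_simp; norm_num
        linarith
      exact_mod_cast hsep.encard_le_of_near (by positivity) hδ fun p hp => hp.2
    · obtain ⟨q, hq, p, hp, hpx⟩ := hx.1 N
      exact ⟨q, hq, p, ⟨hp, x, hx.2, hpx⟩, hpx⟩

theorem dimH_approxSet_le {P : ℕ → Set F} (hP : IsChoice P) {t : ℝ} (ht : 1 ≤ t) :
    dimH (approxSet P t) ≤ (packingDim (univ : Set F) + 1) / ENNReal.ofReal t := by
  have ht0 : 0 < t := one_pos.trans_le ht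
  rw [ENNReal.le_div_iff_mul_le (by simp [ht0]) (by simp)]
  refine le_of_forall_gt_imp_ge_of_dense fun d hd => ?_
  rcases eq_or_ne d ∞ with rfl | htop
  · exact le_top
  lift d to ℝ≥0 using htop
  have h1 : (1 : ℝ≥0) ≤ d := by exact_mod_cast le_add_self.trans hd.le
  obtain ⟨s, rfl⟩ := exists_add_of_le h1
  have hs : packingDim (univ : Set F) < s := by
    rw [add_comm 1 s, ENNReal.coe_add, ENNReal.coe_one] at hd
    exact lt_of_add_lt_add_right hd
  simp only [packingDim, iInf_lt_iff] at hs
  obtain ⟨A, hA, hAs⟩ := hs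
  rw [← inter_univ (approxSet P t), hA, inter_iUnion, dimH_iUnion,
    ← ENNReal.le_div_iff_mul_le (by simp [ht0]) (by simp)]
  refine iSup_le fun i => (dimH_approxSet_inter_le hP ht ((le_iSup _ i).trans_lt hAs)).trans ?_
  rw [ENNReal.ofReal_div_of_pos ht0, add_comm 1 s, ← NNReal.coe_one, ← NNReal.coe_add,
    ENNReal.ofReal_coe_nnreal]

/-! ### Lower bound for the packing dimension, by Baire category. -/

theorem IsChoice.exists_dist_lt {P : ℕ → Set F} (hP : IsChoice P) {q : ℕ} (hq : 1 ≤ q) (x : F) :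
    ∃ p ∈ P q, dist p x < 1 / (q : ℝ) := by
  by_contra! hfar
  have hmem : insert x (P q) ⊆ P q := (hP q hq).le_of_ge (y := insert x (P q)) ?_
    (subset_insert x _)
  · have h1 := hfar x (hmem (mem_insert x _))
    have : 0 < 1 / (q : ℝ) := by positivity
    rw [dist_self] at h1
    linarith
  · rintro p (rfl | hp) p' (rfl | hp') hne
    · exact absurd rfl hne
    · rw [dist_comm]; exact hfar p' hp'
    · exact hfar p hp
    · exact (hP q hq).prop p hp p' hp' hne

/-- In a complete space the approximation sets are comeagre, hence any countable decomposition has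
a piece that is dense in some ball. -/
theorem exists_closedBall_subset_closure [Nonempty F] [CompleteSpace F] {P : ℕ → Set F}
    (hP : IsChoice P) (t : ℝ) {A : ℕ → Set F} (hA : approxSet P t = ⋃ i, A i) :
    ∃ i x, ∃ R > 0, Metric.closedBall x R ⊆ closure (A i) := by
  let U : ℕ → Set F := fun N => ⋃ q > N, ⋃ p ∈ P q, Metric.ball p (1 / (q : ℝ) ^ t)
  have hUo : ∀ N, IsOpen (U N) := fun N =>
    isOpen_biUnion fun q _ => isOpen_biUnion fun p _ => Metric.isOpen_ball
  -- The centres alone are already dense; the radii need only be positive.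
  have hUd : ∀ N, Dense (U N) := fun N => Metric.dense_iff.2 fun x r hr => by
    obtain ⟨n, hn⟩ := exists_nat_one_div_lt hr
    obtain ⟨p, hp, hpx⟩ := hP.exists_dist_lt (q := n + N + 1) (by omega) x
    refine ⟨p, hpx.trans (lt_of_le_of_lt ?_ hn), ?_⟩
    · refine one_div_le_one_div_of_le (by positivity) ?_
      push_cast
      linarith [(Nat.cast_nonneg N : (0 : ℝ) ≤ N)]
    · exact mem_biUnion (show n + N + 1 > N by omega)
        (mem_biUnion hp (Metric.mem_ball_self (by positivity)))
  have hsub : (⋂ N, U N) ⊆ ⋃ i, closure (A i) := fun x hx => by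
    have hx' : x ∈ approxSet P t := fun N => by
      obtain ⟨q, hq, p, hp, hpx⟩ : ∃ q > N, ∃ p ∈ P q, x ∈ Metric.ball p (1 / (q : ℝ) ^ t) := by
        simpa only [U, mem_iUnion, exists_prop] using mem_iInter.1 hx N
      exact ⟨q, hq, p, hp, by rw [dist_comm]; exact (Metric.mem_ball.1 hpx).le⟩
    rw [hA] at hx'
    exact iUnion_mono (fun i => subset_closure) hx'
  obtain ⟨x, hx⟩ := ((IsGδ.iInter_of_isOpen hUo).dense_iUnion_interior_of_closed
    (dense_iInter_of_isOpen hUo hUd) (fun i => isClosed_closure) hsub).nonempty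
  obtain ⟨i, hi⟩ := mem_iUnion.1 hx
  obtain ⟨R, hR, hsubR⟩ := Metric.nhds_basis_closedBall.mem_iff.1 (mem_interior_iff_mem_nhds.1 hi)
  exact ⟨i, x, R, hR, hsubR⟩

theorem LowerScaling.le_upperBoxDim {s : ℝ≥0} (hs : LowerScaling (univ : Set F) s)
    (hF : ¬ (univ : Set F).Subsingleton) {X : Set F} {x : F} {R : ℝ} (hR : 0 < R)
    (hX : Metric.closedBall x R ⊆ closure X) : (s : ℝ≥0∞) ≤ upperBoxDim X := by
  obtain ⟨C, hC, hscal⟩ := hs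
  obtain ⟨R', hR', hR'R, hdiam⟩ : ∃ R' > 0, R' ≤ R ∧
      ENNReal.ofReal R' ≤ Metric.ediam (univ : Set F) := by
    rw [not_subsingleton_iff] at hF
    obtain ⟨a, ha, b, hb, hab⟩ := hF
    refine ⟨min R (dist a b), lt_min hR (dist_pos.2 hab), min_le_left _ _, ?_⟩
    refine (ENNReal.ofReal_le_ofReal (min_le_right _ _)).trans ?_
    rw [← edist_dist]
    exact Metric.edist_le_ediam_of_mem ha hb
  -- The gap between s' and s absorbs the constant C (R'/2)^s as r → 0.
  refine le_of_forall_lt_imp_le_of_dense fun s' hs' => ?_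
  lift s' to ℝ≥0 using (hs'.trans ENNReal.coe_lt_top).ne
  have hlt : (0 : ℝ) < (s : ℝ) - s' := by
    rw [sub_pos]; exact_mod_cast hs'
  refine AbstractRationals.le_upperBoxDim (Eventually.frequently ?_)
  have hlim : ∀ᶠ r : ℝ in 𝓝[>] 0, r ^ ((s : ℝ) - s') < C * (R' / 2) ^ (s : ℝ) := by
    have h : Tendsto (fun r : ℝ => r ^ ((s : ℝ) - s')) (𝓝[>] 0) (𝓝 0) := by
      have := (Real.continuousAt_rpow_const 0 ((s : ℝ) - s') (Or.inr hlt.le)).tendsto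
      rw [Real.zero_rpow hlt.ne'] at this
      exact this.mono_left nhdsWithin_le_nhds
    exact h.eventually_lt_const (by positivity)
  filter_upwards [hlim, Ioo_mem_nhdsGT (show (0 : ℝ) < R' / 2 by positivity)] with r hr hrR
  have hr0 : 0 < r := hrR.1
  -- Points 2r apart, each moved by at most r/2 into X, remain r apart.
  have h1 := hscal (2 * r) R' (by linarith) (by linarith [hrR.2]) hdiam x (mem_univ x)
  have h2 : sepNum (2 * r) (Metric.closedBall x R' ∩ univ) ≤ sepNum r X := by
    refine sepNum_le_of_near (δ := r / 2) hr0 (by linarith) fun p hp => ?_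
    obtain ⟨y, hy, hpy⟩ := Metric.mem_closure_iff.1
      (hX (Metric.closedBall_subset_closedBall hR'R hp.1)) (r / 2) (by linarith)
    exact ⟨y, hy, hpy.le⟩
  refine lt_of_lt_of_le ?_ (h1.trans (by exact_mod_cast h2))
  rw [ENNReal.ofReal_lt_ofReal_iff (by positivity)]
  have h3 : R' / (2 * r) = R' / 2 / r := by field_simp
  rw [h3, Real.div_rpow (by positivity) hr0.le, ← mul_div_assoc, lt_div_iff₀ (by positivity),
    ← Real.rpow_add hr0]
  rwa [neg_add_eq_sub]

theorem lowerDim_le_packingDim_approxSet [Nonempty F] [CompleteSpace F] {P : ℕ → Set F}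
    (hP : IsChoice P) (t : ℝ) : lowerDim (univ : Set F) ≤ packingDim (approxSet P t) := by
  unfold lowerDim
  split_ifs with hF
  · exact zero_le
  · refine iSup₂_le fun s hs => le_iInf₂ fun A hA => ?_
    obtain ⟨i, x, R, hR, hsub⟩ := exists_closedBall_subset_closure hP t hA
    exact (hs.le_upperBoxDim hF hR hsub).trans (le_iSup (fun i => upperBoxDim (A i)) i)

end AbstractRationals

theorem theorem2p1 {F : Type*} [MetricSpace F] [Nonempty F]
    (hF : TotallyBounded (Set.univ : Set F))
    (P : ℕ → Set F) (hP : AbstractRationals.IsChoice P) (t : ℝ) (ht : 1 ≤ t) :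
    dimH (AbstractRationals.approxSet P t) ≤
        (AbstractRationals.packingDim (Set.univ : Set F) + 1) / ENNReal.ofReal t ∧
      (CompactSpace F →
        AbstractRationals.lowerDim (Set.univ : Set F) / ENNReal.ofReal t ≤
          AbstractRationals.packingDim (AbstractRationals.approxSet P t)) := by
  refine ⟨AbstractRationals.dimH_approxSet_le hP ht, fun _ => ?_⟩
  refine le_trans ?_ (AbstractRationals.lowerDim_le_packingDim_approxSet hP t)
  exact ENNReal.div_le_of_le_mul (le_mul_of_one_le_right' (ENNReal.one_le_ofReal.2 ht))
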